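/- Let $A$ be a finite alphabet whose letters represent elements of a semigroup $S$ (via a map $A\to S$, not necessarily injective, whose image generates $S$ as a semigroup); each word $w\in A^+$ then represents an element of $S$, and for $p,q\in A^+$ we write $p=_S q$ if $p$ and $q$ represent the same element. For a language $L\subseteq A^+$ put \[ M(L)=\{\,u\,\#_1\,v\,\#_2\,w^{\mathrm{rev}} : u,v,w\in L,\ uv=_S w\,\}, \] where $\#_1,\#_2$ are two distinct symbols not in $A$ and $w^{\mathrm{rev}}$ is the reverse of $w$. The pair $(L,M(L))$ is a word-hyperbolic structure for $S$ if $L$ is regular, every element of $S$ is represented by at least one word of $L$, and $M(L)$ is context-free. A semigroup is word-hyperbolic (in the sense of Duncan and Gilman) if it admits a word-hyperbolic structure for some such finite alphabet $A$. Theorem. Let $S$ be a word-hyperbolic semigroup and let $T$ be a large subsemigroup of $S$, that is, a subsemigroup such that $S\setminus T$ is finite. Then $T$ is word-hyperbolic. -/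

import Mathlib

namespace WordHyp

/-- The product in a semigroup `S` of the letters of a word over an alphabet `A` whose letters
represent elements of `S` through `φ`. It lives in `WithOne S` only so that the empty word has a
value (the adjoined `1`, which is no element of `S`); a nonempty word represents `s : S` exactly
when its value is `(s : WithOne S)`. -/
def value {A S : Type*} [Semigroup S] (φ : A → S) (w : List A) : WithOne S :=
  (w.map (fun a => (φ a : WithOne S))).prod

/-- The alphabet `A` together with the two new symbols `#₁ = Sum.inr 0` and `#₂ = Sum.inr 1`. -/
abbrev Marked (A : Type*) := A ⊕ Fin 2

/-- The word `u #₁ v #₂ wʳᵉᵛ`. -/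
def encode {A : Type*} (u v w : List A) : List (Marked A) :=
  u.map Sum.inl ++ Sum.inr 0 :: (v.map Sum.inl ++ Sum.inr 1 :: w.reverse.map Sum.inl)

/-- `M(L) = {u #₁ v #₂ wʳᵉᵛ : u, v, w ∈ L, uv =_S w}`. -/
def multLanguage {A S : Type*} [Semigroup S] (φ : A → S) (L : Language A) :
    Language (Marked A) :=
  {x | ∃ u ∈ L, ∃ v ∈ L, ∃ w ∈ L, value φ (u ++ v) = value φ w ∧ x = encode u v w}

/-- The pair `(L, M(L))` is a word-hyperbolic structure for `S`, where the (finite) alphabet `A`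
represents a generating set of `S` through `φ`. -/
structure IsWordHyperbolicStructure {A S : Type*} [Semigroup S] (φ : A → S) (L : Language A) :
    Prop where
  generates : Subsemigroup.closure (Set.range φ) = ⊤
  regular : L.IsRegular
  /-- Words over `A` represent elements of the semigroup `S`, so `L ⊆ A⁺`. -/
  nil_notMem : [] ∉ L
  onto : ∀ s : S, ∃ w ∈ L, value φ w = (s : WithOne S)
  contextFree : (multLanguage φ L).IsContextFree

/-- A semigroup is word-hyperbolic if it admits a word-hyperbolic structure over some finite
alphabet. -/
def IsWordHyperbolic (S : Type*) [Semigroup S] : Prop :=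
  ∃ (A : Type) (_ : Finite A) (φ : A → S) (L : Language A), IsWordHyperbolicStructure φ L

/-- A subsemigroup `T` of `S` is large if its Rees index `|S - T| + 1` is finite. -/
def IsLarge {S : Type*} [Semigroup S] (T : Subsemigroup S) : Prop :=
  ((T : Set S)ᶜ).Finite

end WordHyp

/-! Let `G` be the complement of `T` with the empty product 1 adjoined: a finite set whose
complement, namely `T`, is closed under multiplication. A word over `A` with value in `T` can be cut
into segments `x a y`, each with value in `T`, where `a` is a letter and `x`, `y` have values in
`G`. Segment values have the form `g * φ a * g'`, so only finitely many arise; they are the letters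
of the new alphabet. Replacing each segment by its letter preserves the value.

This rewriting is a rational relation: closure of `T` makes each value class in `G` regular
(`isRegular_value_eq`), hence so are the segments and their star. Applied to `L` it gives a regular
language onto `T` (`exists_mem_kstar_segments`). Applied to all three components of `M(L)` it gives
the new multiplication language, because equality of values is preserved. Context-freeness survives
by `Language.IsContextFree.transduce`, proved by the triple construction. -/

namespace Language

/-! ### Closure of regular languages, by counting left quotients -/

section Regular

variable {α β γ : Type*}

theorem IsRegular.of_leftQuotient_mem {L : Language α} {F : Set (Language α)} (hF : F.Finite)
    (h : ∀ x, L.leftQuotient x ∈ F) : L.IsRegular :=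
  .of_finite_range_leftQuotient (hF.subset (Set.range_subset_iff.2 h))

theorem isRegular_iSup {ι : Type*} [Finite ι] {L : ι → Language α}
    (h : ∀ i, (L i).IsRegular) : (⨆ i, L i).IsRegular := by
  refine .of_leftQuotient_mem
    ((Set.Finite.pi' fun i => (h i).finite_range_leftQuotient).image fun f => ⨆ i, f i) fun x => ?_
  refine ⟨fun i => (L i).leftQuotient x, fun i => ⟨x, rfl⟩, ?_⟩
  ext y
  simp [mem_iSup]

theorem isRegular_singleton (a : α) : ({[a]} : Language α).IsRegular := by
  refine .of_leftQuotient_mem (F := {{[a]}, {[]}, 0}) (by simp) fun x => ?_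
  rcases x with - | ⟨b, - | ⟨d, x⟩⟩
  · exact Or.inl rfl
  · by_cases hb : b = a
    · subst hb
      refine Or.inr (Or.inl ?_)
      ext y
      change [b] ++ y = [b] ↔ y = []
      simp
    · refine Or.inr (Or.inr ?_)
      ext y
      change [b] ++ y = [a] ↔ False
      simp [hb]
  · refine Or.inr (Or.inr ?_)
    ext y
    change (b :: d :: x) ++ y = [a] ↔ False
    simp

/-- After reading `x`, either the `K`-factor is unfinished, or it ended at `y` and the rest `z` of
`x` lies in the `L`-factor. So the quotient is fixed by one quotient of `K` and a set of quotients
of `L`. -/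
theorem IsRegular.mul {K L : Language α} (hK : K.IsRegular) (hL : L.IsRegular) :
    (K * L).IsRegular := by
  refine .of_leftQuotient_mem
    (Set.Finite.image2 (fun (Q : Language α) (X : Set (Language α)) => Q * L + ⨆ l : X, l.1)
      hK.finite_range_leftQuotient hL.finite_range_leftQuotient.powerset) fun x => ?_
  refine ⟨_, ⟨x, rfl⟩, {l | ∃ y z, x = y ++ z ∧ y ∈ K ∧ L.leftQuotient z = l}, ?_, ?_⟩
  · rintro _ ⟨y, z, -, -, rfl⟩
    exact ⟨z, rfl⟩
  · ext v
    simp only [mem_add, mem_mul, mem_iSup, mem_leftQuotient]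
    constructor
    · rintro (⟨a, ha, b, hb, rfl⟩ | ⟨⟨_, y, z, rfl, hy, rfl⟩, hv⟩)
      · exact ⟨x ++ a, ha, b, hb, by simp⟩
      · exact ⟨y, hy, z ++ v, hv, by simp⟩
    · rintro ⟨a, ha, b, hb, hab⟩
      rcases List.append_eq_append_iff.1 hab with ⟨d, rfl, rfl⟩ | ⟨d, rfl, rfl⟩
      · exact Or.inr ⟨⟨_, a, d, rfl, ha, rfl⟩, hb⟩
      · exact Or.inl ⟨d, ha, b, hb, rfl⟩

theorem IsRegular.kstar {L : Language α} (hL : L.IsRegular) : (KStar.kstar L).IsRegular := by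
  refine .of_leftQuotient_mem
    (((hL.finite_range_leftQuotient.powerset).image fun X : Set (Language α) =>
      (⨆ l : X, l.1) * KStar.kstar L).insert (KStar.kstar L)) fun x => ?_
  -- The formula for nonempty `x` completes a factor begun in `x`; at `x = []` it could miss the
  -- empty word.
  rcases eq_or_ne x [] with rfl | hx
  · exact Or.inl rfl
  refine Or.inr ⟨{l | ∃ y z, x = y ++ z ∧ y ∈ KStar.kstar L ∧ L.leftQuotient z = l}, ?_, ?_⟩
  · rintro _ ⟨y, z, -, -, rfl⟩
    exact ⟨z, rfl⟩
  · ext v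
    simp only [mem_mul, mem_iSup, mem_leftQuotient]
    constructor
    · rintro ⟨a, ⟨⟨_, y, z, rfl, ⟨l, rfl, hl⟩, rfl⟩, ha⟩, b, ⟨m, rfl, hm⟩, rfl⟩
      refine ⟨l ++ (z ++ a) :: m, by simp, ?_⟩
      intro u hu
      rcases List.mem_append.1 hu with hu | hu
      · exact hl u hu
      · rcases List.mem_cons.1 hu with rfl | hu
        · exact ha
        · exact hm u hu
    · rintro ⟨l, hl, h⟩
      rcases List.append_eq_flatten_iff.1 hl with ⟨as, bs, rfl, rfl, rfl⟩ |
        ⟨as, bs, c, cs, ds, rfl, rfl, rfl⟩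
      · rcases List.eq_nil_or_concat as with rfl | ⟨as, a, rfl⟩
        · simp at hx
        -- When `x` ends between two factors, its last factor counts as the one in progress, with
        -- empty remainder.
        · refine ⟨[], ⟨⟨_, as.flatten, a, by simp, ⟨as, rfl, ?_⟩, rfl⟩, ?_⟩, bs.flatten,
            ⟨bs, rfl, ?_⟩, rfl⟩
          · intro y hy
            exact h y (by simp [hy])
          · simpa using h a (by simp)
          · intro y hy
            exact h y (by simp [hy])
      · refine ⟨c :: cs, ⟨⟨_, as.flatten, bs, rfl, ⟨as, rfl, ?_⟩, rfl⟩, ?_⟩, ds.flatten,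
          ⟨ds, rfl, ?_⟩, rfl⟩
        · intro y hy
          exact h y (by simp [hy])
        · exact h (bs ++ c :: cs) (by simp)
        · intro y hy
          exact h y (by simp [hy])

/-- The image of a regular language under a map sending each letter to a letter or to the empty
word. -/
theorem IsRegular.image_filterMap {L : Language α} (hL : L.IsRegular) (f : α → Option β) :
    Language.IsRegular ({y | ∃ x ∈ L, x.filterMap f = y} : Language β) := by
  refine .of_leftQuotient_mem
    ((hL.finite_range_leftQuotient.powerset).image fun X : Set (Language α) =>
      ({y | ∃ l ∈ X, ∃ x ∈ l, x.filterMap f = y} : Language β)) fun u => ?_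
  refine ⟨{l | ∃ x, x.filterMap f = u ∧ L.leftQuotient x = l}, ?_, ?_⟩
  · rintro _ ⟨x, -, rfl⟩
    exact ⟨x, rfl⟩
  · ext v
    change (∃ l, (∃ x, x.filterMap f = u ∧ L.leftQuotient x = l) ∧ ∃ x ∈ l, x.filterMap f = v) ↔
      ∃ x ∈ L, x.filterMap f = u ++ v
    constructor
    · rintro ⟨_, ⟨x, rfl, rfl⟩, z, hz, rfl⟩
      exact ⟨x ++ z, hz, by simp⟩
    · rintro ⟨x, hx, h⟩
      obtain ⟨y, z, rfl, rfl, rfl⟩ := List.filterMap_eq_append_iff.1 h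
      exact ⟨_, ⟨y, rfl, rfl⟩, z, hx, rfl⟩

theorem IsRegular.map {L : Language α} (hL : L.IsRegular) (f : α → β) :
    (Language.map f L).IsRegular := by
  have h := hL.image_filterMap fun a => some (f a)
  simp only [List.filterMap_eq_map'] at h
  exact h

theorem IsRegular.comap {L : Language β} (hL : L.IsRegular) (f : α → β) :
    Language.IsRegular ({x | x.map f ∈ L} : Language α) := by
  obtain ⟨σ, _, M, rfl⟩ := hL
  exact ⟨σ, inferInstance, M.comap f, M.accepts_comap f⟩

end Regular

end Language

/-! ### Parse forests -/

namespace ContextFreeGrammar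

variable {T : Type*}

/-- `g.Yields xs w` says that the word `w` of terminals is derived from the sentential form `xs`,
by an induction along the parse forest. -/
inductive Yields (g : ContextFreeGrammar T) : List (Symbol T g.NT) → List T → Prop
  | nil : g.Yields [] []
  | terminal (a : T) {xs : List (Symbol T g.NT)} {w : List T} :
      g.Yields xs w → g.Yields (Symbol.terminal a :: xs) (a :: w)
  | nonterminal {r : ContextFreeRule T g.NT} {xs : List (Symbol T g.NT)} {u w : List T} :
      r ∈ g.rules → g.Yields r.output u → g.Yields xs w →
      g.Yields (Symbol.nonterminal r.input :: xs) (u ++ w)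

variable {g : ContextFreeGrammar T}

theorem yields_map_terminal (w : List T) : g.Yields (w.map Symbol.terminal) w := by
  induction w with
  | nil => exact .nil
  | cons a w ih => exact .terminal a ih

theorem Yields.eq_of_map_terminal {v w : List T} (h : g.Yields (v.map Symbol.terminal) w) :
    w = v := by
  induction v generalizing w with
  | nil => cases h; rfl
  | cons a v ih =>
    cases h with
    | terminal _ h => rw [ih h]

theorem Yields.append {xs ys : List (Symbol T g.NT)} {u v : List T} (hx : g.Yields xs u)
    (hy : g.Yields ys v) : g.Yields (xs ++ ys) (u ++ v) := by
  induction hx with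
  | nil => exact hy
  | terminal a _ ih => exact .terminal a ih
  | nonterminal hr ho _ _ ih =>
    rw [List.append_assoc]
    exact .nonterminal hr ho ih

theorem Yields.exists_of_append {xs ys : List (Symbol T g.NT)} {w : List T}
    (h : g.Yields (xs ++ ys) w) : ∃ u v, w = u ++ v ∧ g.Yields xs u ∧ g.Yields ys v := by
  induction xs generalizing w with
  | nil => exact ⟨[], w, rfl, .nil, h⟩
  | cons x xs ih =>
    cases h with
    | terminal a h =>
      obtain ⟨u, v, rfl, hu, hv⟩ := ih h
      exact ⟨_, v, rfl, .terminal a hu, hv⟩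
    | nonterminal hr ho h =>
      obtain ⟨u, v, rfl, hu, hv⟩ := ih h
      exact ⟨_, v, (List.append_assoc ..).symm, .nonterminal hr ho hu, hv⟩

theorem Yields.derives {xs : List (Symbol T g.NT)} {w : List T} (h : g.Yields xs w) :
    g.Derives xs (w.map Symbol.terminal) := by
  induction h with
  | nil => rfl
  | terminal a _ ih => exact ih.append_left [Symbol.terminal a]
  | @nonterminal r xs u w hr _ _ iho ih =>
    rw [List.map_append]
    have h1 : g.Produces (Symbol.nonterminal r.input :: xs) (r.output ++ xs) := ⟨r, hr, .head _⟩
    exact (h1.single.trans (iho.append_right xs)).trans (ih.append_left _)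

theorem Yields.of_produces {xs ys : List (Symbol T g.NT)} {w : List T} (h : g.Produces xs ys)
    (hy : g.Yields ys w) : g.Yields xs w := by
  obtain ⟨r, hr, h⟩ := h
  obtain ⟨p, q, rfl, rfl⟩ := h.exists_parts
  obtain ⟨u, v, rfl, hu, hv⟩ := hy.exists_of_append
  obtain ⟨u, u', rfl, hp, ho⟩ := hu.exists_of_append
  refine Yields.append (hp.append ?_) hv
  simpa using Yields.nonterminal hr ho .nil

theorem derives_map_terminal_iff_yields {xs : List (Symbol T g.NT)} {w : List T} :
    g.Derives xs (w.map Symbol.terminal) ↔ g.Yields xs w := by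
  refine ⟨fun h => ?_, Yields.derives⟩
  induction h using Relation.ReflTransGen.head_induction_on with
  | refl => exact yields_map_terminal w
  | head h _ ih => exact ih.of_produces h

/-! ### The triple construction -/

section Transduction

/-- The sentential forms `(q₀, x₁, q₁) (q₁, x₂, q₂) ⋯ (qₙ₋₁, xₙ, qₙ)` threading states through
`x₁ ⋯ xₙ`. -/
def threads {σ T N M : Type*} (ι : σ × Symbol T N × σ → M) {β : Type*} :
    σ → List (Symbol T N) → σ → Set (List (Symbol β M))
  | q, [], q' => {ys | q = q' ∧ ys = []}
  | q, x :: xs, q' => {ys | ∃ p zs, zs ∈ threads ι p xs q' ∧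
      ys = Symbol.nonterminal (ι (q, x, p)) :: zs}

theorem finite_threads {σ T N M : Type*} [Finite σ] (ι : σ × Symbol T N × σ → M) {β : Type*}
    (xs : List (Symbol T N)) (q q' : σ) :
    (threads ι q xs q' : Set (List (Symbol β M))).Finite := by
  induction xs generalizing q with
  | nil => exact (Set.finite_singleton []).subset fun ys h => h.2
  | cons x xs ih =>
    refine (Set.finite_iUnion fun p => (ih p).image
      (List.cons (Symbol.nonterminal (ι (q, x, p))))).subset ?_
    rintro _ ⟨p, zs, hz, rfl⟩
    exact Set.mem_iUnion.2 ⟨p, zs, hz, rfl⟩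


variable {T σ : Type} {γ β : Type*} {g : ContextFreeGrammar T}

/-- The rules of the triple construction for the grammar `g`, the automaton `M` and the
letter-to-letter maps `f`, `h`. -/
inductive TransducerRule (g : ContextFreeGrammar T) (M : DFA γ σ) (f : γ → T) (h : γ → Option β) :
    ContextFreeRule β (Option (σ × Symbol T g.NT × σ)) → Prop
  | start {q : σ} : q ∈ M.accept → TransducerRule g M f h
      ⟨none, [Symbol.nonterminal (some (M.start, Symbol.nonterminal g.initial, q))]⟩
  | letter (q : σ) (c : γ) : TransducerRule g M f h
      ⟨some (q, Symbol.terminal (f c), M.step q c), (h c).toList.map Symbol.terminal⟩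
  | thread {r : ContextFreeRule T g.NT} {q q' : σ} {ys} : r ∈ g.rules →
      ys ∈ threads some q r.output q' → TransducerRule g M f h
        ⟨some (q, Symbol.nonterminal r.input, q'), ys⟩

theorem finite_transducerRule [Finite γ] [Finite σ] (g : ContextFreeGrammar T) (M : DFA γ σ)
    (f : γ → T) (h : γ → Option β) : {r | TransducerRule g M f h r}.Finite := by
  have h1 : (Set.range fun q : σ => (⟨none, [Symbol.nonterminal
      (some (M.start, Symbol.nonterminal g.initial, q))]⟩ :
      ContextFreeRule β (Option (σ × Symbol T g.NT × σ)))).Finite := Set.finite_range _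
  have h2 : (Set.range fun p : σ × γ => (⟨some (p.1, Symbol.terminal (f p.2), M.step p.1 p.2),
      (h p.2).toList.map Symbol.terminal⟩ :
      ContextFreeRule β (Option (σ × Symbol T g.NT × σ)))).Finite := Set.finite_range _
  have h3 : (⋃ r ∈ g.rules, ⋃ q : σ, ⋃ q' : σ, (fun ys =>
      (⟨some (q, Symbol.nonterminal r.input, q'), ys⟩ :
      ContextFreeRule β (Option (σ × Symbol T g.NT × σ)))) '' threads some q r.output q').Finite :=
    g.rules.finite_toSet.biUnion fun r _ => Set.finite_iUnion fun q => Set.finite_iUnion fun q' =>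
      (finite_threads _ _ _ _).image _
  refine ((h1.union h2).union h3).subset ?_
  rintro _ (⟨-⟩ | ⟨q, c⟩ | ⟨hr, hy⟩)
  · exact Or.inl (Or.inl ⟨_, rfl⟩)
  · exact Or.inl (Or.inr ⟨(q, c), rfl⟩)
  · refine Or.inr ?_
    simp only [Set.mem_iUnion]
    exact ⟨_, hr, _, _, _, hy, rfl⟩

/-- The grammar of the triple construction. -/
noncomputable def transduce [Finite γ] [Finite σ] (g : ContextFreeGrammar T) (M : DFA γ σ)
    (f : γ → T) (h : γ → Option β) : ContextFreeGrammar β where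
  NT := Option (σ × Symbol T g.NT × σ)
  initial := none
  rules := (finite_transducerRule g M f h).toFinset

variable {M : DFA γ σ} {f : γ → T} {h : γ → Option β}

theorem mem_transduce_rules [Finite γ] [Finite σ]
    {r : ContextFreeRule β (Option (σ × Symbol T g.NT × σ))} :
    r ∈ (transduce g M f h).rules ↔ TransducerRule g M f h r :=
  Set.Finite.mem_toFinset _

/-- The parse forest is relabelled with the states of the run of `M` on `k`. Terminals also become
triples, so that each leaf can choose a letter `c` of `γ` and emit `h c`. -/
theorem Yields.transduce [Finite γ] [Finite σ] {xs : List (Symbol T g.NT)} {k : List γ}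
    (hx : g.Yields xs (k.map f)) (q : σ) :
    ∃ ys ∈ threads some q xs (M.evalFrom q k),
      (transduce g M f h).Yields ys (k.filterMap h) := by
  generalize hw : k.map f = w at hx
  induction hx generalizing k q with
  | nil =>
    obtain rfl := List.map_eq_nil_iff.1 hw
    exact ⟨[], ⟨rfl, rfl⟩, .nil⟩
  | terminal a _ ih =>
    obtain ⟨c, k, rfl, rfl, hk⟩ := List.map_eq_cons_iff.1 hw
    obtain ⟨ys, hys, hy⟩ := ih (M.step q c) hk
    refine ⟨_, ⟨_, ys, hys, rfl⟩, ?_⟩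
    have h1 : (c :: k).filterMap h = (h c).toList ++ k.filterMap h := by
      cases hc : h c <;> simp [hc]
    rw [h1]
    exact .nonterminal (mem_transduce_rules.2 (.letter q c)) (yields_map_terminal _) hy
  | nonterminal hr _ _ iho ih =>
    obtain ⟨k, k', rfl, hk, hk'⟩ := List.map_eq_append_iff.1 hw
    obtain ⟨zs, hzs, hz⟩ := iho q hk
    obtain ⟨ys, hys, hy⟩ := ih (M.evalFrom q k) hk'
    rw [DFA.evalFrom_of_append, List.filterMap_append]
    exact ⟨_, ⟨_, ys, hys, rfl⟩,
      .nonterminal (mem_transduce_rules.2 (.thread hr hzs)) hz hy⟩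

/-- The `letter` rules used at the leaves spell out `k`; forgetting the states leaves a parse forest
for `g`. -/
theorem Yields.exists_of_transduce [Finite γ] [Finite σ] {xs : List (Symbol T g.NT)} {q q' : σ}
    {ys : List (Symbol β (ContextFreeGrammar.transduce g M f h).NT)} {w : List β}
    (hy : (ContextFreeGrammar.transduce g M f h).Yields ys w)
    (hys : ys ∈ (threads some q xs q' :
      Set (List (Symbol β (ContextFreeGrammar.transduce g M f h).NT)))) :
    ∃ k, M.evalFrom q k = q' ∧ k.filterMap h = w ∧ g.Yields xs (k.map f) := by
  induction hy generalizing xs q q' with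
  | nil =>
    cases xs with
    | nil => exact ⟨[], hys.1, rfl, .nil⟩
    | cons x xs =>
      obtain ⟨_, _, _, h⟩ := hys
      cases h
  | terminal a _ ih =>
    cases xs with
    | nil => cases hys.2
    | cons x xs =>
      obtain ⟨_, _, _, h⟩ := hys
      cases h
  | @nonterminal r zs u w hr ho _ iho ih =>
    cases xs with
    | nil => cases hys.2
    | cons x xs =>
      obtain ⟨p, zs, hzs, h⟩ := hys
      obtain ⟨i, o⟩ := r
      injection h with h1 h2
      injection h1 with h1
      subst h1 h2
      obtain ⟨k', rfl, rfl, hk'⟩ := ih hzs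
      cases mem_transduce_rules.1 hr with
      | letter _ c =>
        obtain rfl := ho.eq_of_map_terminal
        refine ⟨c :: k', rfl, ?_, .terminal _ hk'⟩
        cases hc : h c <;> simp [hc]
      | thread hg hz =>
        obtain ⟨k, rfl, rfl, hk⟩ := iho hz
        refine ⟨k ++ k', DFA.evalFrom_of_append .., List.filterMap_append, ?_⟩
        rw [List.map_append]
        exact .nonterminal hg hk hk'

theorem mem_language_transduce [Finite γ] [Finite σ] {w : List β} :
    w ∈ (transduce g M f h).language ↔
      ∃ k ∈ M.accepts, k.map f ∈ g.language ∧ k.filterMap h = w := by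
  simp only [mem_language_iff, derives_map_terminal_iff_yields]
  constructor
  · intro hw
    generalize hi : [Symbol.nonterminal (transduce g M f h).initial] = xs at hw
    cases hw with
    | nil => cases hi
    | terminal a _ => cases hi
    | @nonterminal r _ _ _ hr ho hn =>
      obtain ⟨i, o⟩ := r
      injection hi with h1 h2
      injection h1 with h1
      subst h1 h2
      cases hn
      cases mem_transduce_rules.1 hr with
      | @start q hq =>
        obtain ⟨k, rfl, rfl, hk⟩ := ho.exists_of_transduce
          (xs := [Symbol.nonterminal g.initial]) (q := M.start) (q' := q)
          ⟨q, [], ⟨rfl, rfl⟩, rfl⟩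
        exact ⟨k, hq, hk, by simp⟩
  · rintro ⟨k, hk, hg, rfl⟩
    obtain ⟨ys, ⟨p, zs, ⟨hp, rfl⟩, rfl⟩, hy⟩ := hg.transduce (M := M) (h := h) M.start
    subst hp
    have hs := Yields.nonterminal (mem_transduce_rules.2 (.start hk)) hy .nil
    rw [List.append_nil] at hs
    exact hs

end Transduction

end ContextFreeGrammar

/-- Context-free languages are closed under rational transductions whose transitions read one
letter and write at most one letter. -/
theorem Language.IsContextFree.transduce {α : Type} {β γ : Type*} [Finite γ] {L : Language α}
    (hL : L.IsContextFree) {K : Language γ} (hK : K.IsRegular) (f : γ → α) (h : γ → Option β) :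
    Language.IsContextFree ({w | ∃ k ∈ K, k.map f ∈ L ∧ k.filterMap h = w} : Language β) := by
  obtain ⟨g, rfl⟩ := hL
  obtain ⟨σ, _, M, rfl⟩ := hK
  refine ⟨g.transduce M f h, ?_⟩
  ext w
  exact ContextFreeGrammar.mem_language_transduce

namespace WordHyp

/-! ### Values of words -/

section Value

variable {A S : Type*} [Semigroup S] (φ : A → S)

@[simp]
theorem value_nil : value φ [] = 1 := rfl

@[simp]
theorem value_cons (a : A) (w : List A) : value φ (a :: w) = φ a * value φ w := by
  simp [value]

@[simp]
theorem value_append (u v : List A) : value φ (u ++ v) = value φ u * value φ v := by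
  simp [value]

theorem coe_mul_ne_one (s : S) (m : WithOne S) : (s : WithOne S) * m ≠ 1 := by
  cases m with
  | one => simp
  | coe m => exact WithOne.coe_ne_one

theorem value_eq_one {w : List A} : value φ w = 1 ↔ w = [] := by
  cases w with
  | nil => simp
  | cons a w => simp [coe_mul_ne_one]

theorem exists_coe_eq_value {w : List A} (hw : w ≠ []) :
    ∃ s ∈ Subsemigroup.closure (Set.range φ), value φ w = (s : WithOne S) := by
  induction w with
  | nil => exact absurd rfl hw
  | cons a w ih =>
    have ha : φ a ∈ Subsemigroup.closure (Set.range φ) := Subsemigroup.subset_closure ⟨a, rfl⟩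
    rcases eq_or_ne w [] with rfl | hw
    · exact ⟨φ a, ha, by simp⟩
    · obtain ⟨s, hs, h⟩ := ih hw
      exact ⟨φ a * s, mul_mem ha hs, by simp [h]⟩

theorem encode_injective {u v w u' v' w' : List A} (h : encode u v w = encode u' v' w') :
    u = u' ∧ v = v' ∧ w = w' := by
  have key : ∀ (i : Fin 2) (u u' : List A) (x x' : List (Marked A)),
      u.map Sum.inl ++ Sum.inr i :: x = u'.map Sum.inl ++ Sum.inr i :: x' → u = u' ∧ x = x' := by
    intro i u
    induction u with
    | nil =>
      rintro (- | ⟨a, u'⟩) x x' h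
      · simpa using h
      · simp at h
    | cons a u ih =>
      rintro (- | ⟨a, u'⟩) x x' h
      · simp at h
      · simp only [List.map_cons, List.cons_append, List.cons.injEq, Sum.inl.injEq] at h
        obtain ⟨rfl, rfl⟩ := ih _ _ _ h.2
        exact ⟨by rw [h.1], rfl⟩
  obtain ⟨hu, h⟩ := key _ _ _ _ _ h
  obtain ⟨hv, h⟩ := key _ _ _ _ _ h
  exact ⟨hu, hv, List.reverse_injective (List.map_injective_iff.2 Sum.inl_injective h)⟩

/-- If the complement of a finite set `G` is closed under multiplication, then the words
representing a given element of `G` form a regular language. -/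
theorem isRegular_value_eq {G : Set (WithOne S)} (hG : G.Finite)
    (hmul : ∀ x y, x ∉ G → y ∉ G → x * y ∉ G) {g : WithOne S} (hg : g ∈ G) :
    Language.IsRegular ({w | value φ w = g} : Language A) := by
  refine .of_leftQuotient_mem
    ((hG.image fun m => ({w | m * value φ w = g} : Language A)).union
      (hG.powerset.image fun X => ({w | value φ w ∈ X} : Language A))) fun u => ?_
  by_cases hu : value φ u ∈ G
  · refine Or.inl ⟨_, hu, ?_⟩
    ext v
    change value φ u * value φ v = g ↔ value φ (u ++ v) = g
    rw [value_append]
  -- Once `u` has left `G`, any `v` completing it to a value in `G` must itself have value in `G`.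
  · refine Or.inr ⟨{m | m ∈ G ∧ value φ u * m = g}, fun m hm => hm.1, ?_⟩
    ext v
    change value φ v ∈ G ∧ value φ u * value φ v = g ↔ value φ (u ++ v) = g
    rw [value_append]
    refine ⟨And.right, fun h => ⟨?_, h⟩⟩
    by_contra hv
    exact hmul _ _ hu hv (h ▸ hg)

end Value

theorem isRegular_encode {A : Type*} {K : Language A} (hK : K.IsRegular) :
    Language.IsRegular ({x | ∃ u ∈ K, ∃ v ∈ K, ∃ w ∈ K, x = encode u v w} : Language (Marked A)) := by
  have h := (hK.map Sum.inl).mul ((Language.isRegular_singleton (Sum.inr 0 : Marked A)).mul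
    ((hK.map Sum.inl).mul ((Language.isRegular_singleton (Sum.inr 1 : Marked A)).mul
      (hK.reverse.map Sum.inl))))
  refine (congrArg Language.IsRegular (Language.ext fun x => ?_)).mpr h
  constructor
  · rintro ⟨u, hu, v, hv, w, hw, rfl⟩
    refine ⟨_, ⟨u, hu, rfl⟩, _, ⟨_, rfl, _, ⟨_, ⟨v, hv, rfl⟩, _, ⟨_, rfl, _,
      ⟨w.reverse, ?_, rfl⟩, rfl⟩, rfl⟩, rfl⟩, ?_⟩
    · exact Language.reverse_mem_reverse.2 hw
    · simp [encode]
  · rintro ⟨_, ⟨u, hu, rfl⟩, _, ⟨_, rfl, _, ⟨_, ⟨v, hv, rfl⟩, _, ⟨_, rfl, _,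
      ⟨w, hw, rfl⟩, rfl⟩, rfl⟩, rfl⟩, rfl⟩
    exact ⟨u, hu, v, hv, w.reverse, hw, by simp [encode]⟩

/-! ### Cutting words into segments -/

section Segments

variable {A S B : Type*} [Semigroup S] (φ : A → S) (ψ : B → WithOne S) (G : Set (WithOne S))

/-- The words `x a y` with `x, y` representing elements of `G`, the letter `a` being tagged with a
letter `b` that represents the same element as `x a y`. -/
def segments : Language (A × Option B) :=
  {k | ∃ x a y b, value φ x ∈ G ∧ value φ y ∈ G ∧ value φ (x ++ a :: y) = ψ b ∧
    k = x.map (fun c => (c, none)) ++ (a, some b) :: y.map (fun c => (c, none))}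

variable {φ ψ G}

theorem isRegular_segments [Finite A] [Finite B] (hG : G.Finite)
    (hmul : ∀ x y, x ∉ G → y ∉ G → x * y ∉ G) : (segments φ ψ G).IsRegular := by
  have := hG.to_subtype
  let ι := {p : (G × G) × A × B // p.1.1.1 * (φ p.2.1 * p.1.2.1) = ψ p.2.2}
  let V (g : G) : Language (A × Option B) :=
    Language.map (fun c => (c, none)) ({w | value φ w = g.1} : Language A)
  have hV (g : G) : (V g).IsRegular := (isRegular_value_eq φ hG hmul g.2).map _
  have h := Language.isRegular_iSup fun p : ι =>
    (hV p.1.1.1).mul ((Language.isRegular_singleton (p.1.2.1, some p.1.2.2)).mul (hV p.1.1.2))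
  refine (congrArg Language.IsRegular (Language.ext fun k => ?_)).mpr h
  rw [Language.mem_iSup]
  constructor
  · rintro ⟨x, a, y, b, hx, hy, h, rfl⟩
    rw [value_append, value_cons] at h
    exact ⟨⟨((⟨_, hx⟩, ⟨_, hy⟩), a, b), h⟩, _, ⟨x, rfl, rfl⟩, _, ⟨_, rfl, _, ⟨y, rfl, rfl⟩, rfl⟩,
      rfl⟩
  · rintro ⟨⟨⟨⟨⟨g, hg⟩, ⟨g', hg'⟩⟩, a, b⟩, h⟩, _, ⟨x, rfl, rfl⟩, _,
      ⟨_, rfl, _, ⟨y, rfl, rfl⟩, rfl⟩, rfl⟩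
    refine ⟨x, a, y, b, hg, hg', ?_, rfl⟩
    rwa [value_append, value_cons]

theorem prod_filterMap_of_mem_kstar_segments {k : List (A × Option B)}
    (hk : k ∈ KStar.kstar (segments φ ψ G)) :
    ((k.filterMap Prod.snd).map ψ).prod = value φ (k.map Prod.fst) := by
  obtain ⟨l, rfl, hl⟩ := hk
  induction l with
  | nil => rfl
  | cons k l ih =>
    obtain ⟨x, a, y, b, -, -, h, rfl⟩ := hl k (by simp)
    have hn : ∀ x : List A, (x.map fun c => (c, (none : Option B))).filterMap Prod.snd = [] := by
      intro x
      simp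
    have hf : ∀ x : List A, (x.map fun c => (c, (none : Option B))).map Prod.fst = x := by
      intro x
      simp [Function.comp_def]
    rw [List.flatten_cons, List.filterMap_append, List.map_append, List.prod_append,
      ih fun y hy => hl y (by simp [hy]), List.map_append, value_append]
    congr 1
    rw [List.filterMap_append, hn, List.filterMap_cons_some (f := Prod.snd) (b := b) rfl, hn,
      List.map_append (f := Prod.fst), List.map_cons (f := Prod.fst), hf, hf, h]
    simp

/-- Prefix values start at 1 in `G` and end outside, so some letter `a` takes a prefix `x` out of
`G`. If the remainder `z` has value in `G`, it is absorbed as `y`; otherwise `x a` is a segment and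
`z` is cut recursively. -/
theorem exists_mem_kstar_segments (hone : (1 : WithOne S) ∈ G)
    (hψ : ∀ g ∈ G, ∀ a, ∀ g' ∈ G, g * (φ a * g') ∉ G → ∃ b, g * (φ a * g') = ψ b)
    (w : List A) (hw : value φ w ∉ G) :
    ∃ k ∈ KStar.kstar (segments φ ψ G), k.map Prod.fst = w := by
  obtain ⟨x, a, z, hx, hxa, rfl⟩ : ∃ x a z, value φ x ∈ G ∧ value φ (x ++ [a]) ∉ G ∧
      w = x ++ a :: z := by
    induction w using List.reverseRecOn with
    | nil => exact absurd hone hw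
    | append_singleton w a ih =>
      by_cases h : value φ w ∈ G
      · exact ⟨w, a, [], h, hw, rfl⟩
      · obtain ⟨x, a', z, hx, hxa, rfl⟩ := ih h
        exact ⟨x, a', z ++ [a], hx, hxa, by simp⟩
  by_cases hz : value φ z ∈ G
  · rw [value_append, value_cons] at hw
    obtain ⟨b, hb⟩ := hψ _ hx a _ hz hw
    refine ⟨x.map (fun c => (c, none)) ++ (a, some b) :: z.map (fun c => (c, none)),
      ⟨[_], (List.append_nil _).symm, ?_⟩, ?_⟩
    · intro k hk
      rw [List.mem_singleton] at hk
      exact ⟨x, a, z, b, hx, hz, by rwa [value_append, value_cons], hk⟩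
    · simp [Function.comp_def]
  · obtain ⟨k, ⟨l, rfl, hl⟩, hk⟩ := exists_mem_kstar_segments hone hψ z hz
    rw [value_append, value_cons, value_nil] at hxa
    obtain ⟨b, hb⟩ := hψ _ hx a _ hone hxa
    refine ⟨_, ⟨(x.map (fun c => (c, none)) ++ [(a, some b)]) :: l, rfl, ?_⟩, ?_⟩
    · intro k hk
      rcases List.mem_cons.1 hk with rfl | hk
      · exact ⟨x, a, [], b, hx, hone, by rwa [value_append, value_cons], rfl⟩
      · exact hl k hk
    · simp [hk, Function.comp_def]
  termination_by w.length
  decreasing_by subst_vars; simp; omega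

end Segments

/-! ### Transporting the multiplication language -/

section Transfer

variable {S T : Type*} [Semigroup S] [Semigroup T]

/-- The transducer is controlled by encoded triples from `K`, keeps the markers and erases untagged
letters. `hval` matches the two product equations. -/
theorem isContextFree_multLanguage_image {A B : Type} [Finite A] [Finite B] {φ : A → S} {ψ : B → T}
    {L : Language A} (hL : (multLanguage φ L).IsContextFree) {K : Language (A × Option B)}
    (hK : K.IsRegular)
    (hval : ∀ u ∈ K, ∀ v ∈ K, ∀ w ∈ K,
      value φ (u.map Prod.fst ++ v.map Prod.fst) = value φ (w.map Prod.fst) ↔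
        value ψ (u.filterMap Prod.snd ++ v.filterMap Prod.snd) = value ψ (w.filterMap Prod.snd)) :
    (multLanguage ψ ({y | ∃ k ∈ K, k.map Prod.fst ∈ L ∧ k.filterMap Prod.snd = y} :
      Language B)).IsContextFree := by
  have hf (u v w : List (A × Option B)) : (encode u v w).map (Sum.map Prod.fst id) =
      encode (u.map Prod.fst) (v.map Prod.fst) (w.map Prod.fst) := by
    simp [encode, Function.comp_def]
  have hs (u v w : List (A × Option B)) :
      (encode u v w).filterMap (Sum.elim (fun c => c.2.map Sum.inl) fun i => some (Sum.inr i)) =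
      encode (u.filterMap Prod.snd) (v.filterMap Prod.snd) (w.filterMap Prod.snd) := by
    simp [encode, List.filterMap_map, List.map_filterMap, Function.comp_def]
  have h := hL.transduce (isRegular_encode hK) (Sum.map Prod.fst id)
    (Sum.elim (fun c => c.2.map (Sum.inl : B → Marked B)) fun i => some (Sum.inr i))
  refine (congrArg Language.IsContextFree (Language.ext fun x => ?_)).mpr h
  constructor
  · rintro ⟨_, ⟨u, hu, huL, rfl⟩, _, ⟨v, hv, hvL, rfl⟩, _, ⟨w, hw, hwL, rfl⟩, h, rfl⟩
    refine ⟨_, ⟨u, hu, v, hv, w, hw, rfl⟩, ?_, hs u v w⟩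
    rw [hf]
    exact ⟨_, huL, _, hvL, _, hwL, (hval u hu v hv w hw).2 h, rfl⟩
  · rintro ⟨_, ⟨u, hu, v, hv, w, hw, rfl⟩, h, rfl⟩
    rw [hf] at h
    obtain ⟨_, hu', _, hv', _, hw', h, he⟩ := h
    obtain ⟨rfl, rfl, rfl⟩ := encode_injective he
    exact ⟨_, ⟨u, hu, hu', rfl⟩, _, ⟨v, hv, hv', rfl⟩, _, ⟨w, hw, hw', rfl⟩,
      (hval u hu v hv w hw).1 h, hs u v w⟩

end Transfer

end WordHyp

/-! ### The theorem -/

open WordHyp in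
theorem mainTheorem1 {S : Type*} [Semigroup S] (hS : WordHyp.IsWordHyperbolic S)
    (T : Subsemigroup S) (hT : WordHyp.IsLarge T) : WordHyp.IsWordHyperbolic T := by
  obtain ⟨A, _, φ, L, hL⟩ := hS
  let j : WithOne T →* WithOne S := WithOne.mapMulHom (MulMemClass.subtype T)
  have hj : Function.Injective j := WithOne.mapMulHom_injective Subtype.val_injective
  let G : Set (WithOne S) := insert 1 ((fun s : S => (s : WithOne S)) '' (T : Set S)ᶜ)
  have hG : G.Finite := (hT.image _).insert 1
  have hGT (x : WithOne S) : x ∉ G ↔ ∃ t : T, x = ((t : S) : WithOne S) := by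
    cases x with
    | one => simp [G]
    | coe s => simp [G]
  have hmul (x y : WithOne S) (hx : x ∉ G) (hy : y ∉ G) : x * y ∉ G := by
    obtain ⟨s, rfl⟩ := (hGT x).1 hx
    obtain ⟨t, rfl⟩ := (hGT y).1 hy
    exact (hGT _).2 ⟨s * t, rfl⟩
  have hX : {t : T | ∃ p : G × A × G,
      p.1.1 * (φ p.2.1 * p.2.2.1) = ((t : S) : WithOne S)}.Finite := by
    have := hG.to_subtype
    refine ((Set.finite_range fun p : G × A × G => p.1.1 * (φ p.2.1 * p.2.2.1)).preimage
      (f := fun t : T => ((t : S) : WithOne S)) ?_)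
    exact (WithOne.coe_injective.comp Subtype.val_injective).injOn
  -- The alphabet must lie in `Type`, whatever the universe of `S`, so the segment values are
  -- indexed by `Fin n`.
  obtain ⟨n, ψ, -, hψ⟩ := hX.fin_param
  have hψS (t : T) : (∃ b, ψ b = t) ↔
      ∃ p : G × A × G, p.1.1 * (φ p.2.1 * p.2.2.1) = ((t : S) : WithOne S) :=
    Set.ext_iff.1 hψ t
  let ψS (b : Fin n) : WithOne S := ((ψ b : S) : WithOne S)
  have hjv (u : List (Fin n)) : j (value ψ u) = (u.map ψS).prod := by
    rw [value, map_list_prod, List.map_map]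
    rfl
  let K := KStar.kstar (segments φ ψS G)
  have hK : K.IsRegular := (isRegular_segments hG hmul).kstar
  have hKval (k : List (A × Option (Fin n))) (hk : k ∈ K) :
      j (value ψ (k.filterMap Prod.snd)) = value φ (k.map Prod.fst) :=
    (hjv _).trans (prod_filterMap_of_mem_kstar_segments hk)
  have hdec := exists_mem_kstar_segments (φ := φ) (ψ := ψS) (G := G) (Set.mem_insert _ _) (by
    intro g hg a g' hg' h
    obtain ⟨t, ht⟩ := (hGT _).1 h
    obtain ⟨b, rfl⟩ := (hψS t).2 ⟨(⟨g, hg⟩, a, ⟨g', hg'⟩), ht⟩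
    exact ⟨b, ht⟩)
  let L' : Language (Fin n) := {y | ∃ k ∈ K, k.map Prod.fst ∈ L ∧ k.filterMap Prod.snd = y}
  have hnil : [] ∉ L' := by
    rintro ⟨k, hk, hkL, h⟩
    have h1 := hKval k hk
    rw [h, value_nil, map_one, eq_comm, value_eq_one] at h1
    exact hL.nil_notMem (h1 ▸ hkL)
  have honto (t : T) : ∃ w ∈ L', value ψ w = (t : WithOne T) := by
    obtain ⟨w, hw, hwt⟩ := hL.onto t
    obtain ⟨k, hk, rfl⟩ := hdec w ((hGT _).2 ⟨t, hwt⟩)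
    refine ⟨_, ⟨k, hk, hw, rfl⟩, hj ?_⟩
    rw [hKval k hk, hwt]
    rfl
  refine ⟨Fin n, inferInstance, ψ, L', ?_, ?_, hnil, honto, ?_⟩
  -- Generation follows from `honto`, since the representing words are nonempty.
  · refine (Subsemigroup.eq_top_iff' _).2 fun t => ?_
    obtain ⟨w, hw, hwt⟩ := honto t
    obtain ⟨s, hs, h⟩ := exists_coe_eq_value ψ (w := w) (fun h => hnil (h ▸ hw))
    rw [hwt, WithOne.coe_inj] at h
    exact h ▸ hs
  · refine (congrArg Language.IsRegular (Language.ext fun y => ?_)).mpr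
      ((hK.inf (hL.regular.comap Prod.fst)).image_filterMap Prod.snd)
    exact exists_congr fun k => and_assoc.symm
  · refine isContextFree_multLanguage_image hL.contextFree hK fun u hu v hv w hw => ?_
    rw [← hj.eq_iff, value_append, value_append, map_mul, hKval u hu, hKval v hv, hKval w hw]
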